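/- Let $d\in\{2,3,4,\dots\}\cup\{\infty\}$, let $\mathbf n=(n_j)_{j=1}^d$ be a $d$-tuple of distinct integers $n_j\ge 2$, and let $\mathbf b=(b_j)_{j=1}^d$ be a $d$-tuple of positive real numbers such that either $\sum_{j=1}^d b_j=1$, or $\sum_{j=1}^d b_j<1$ and $\sigma_a\big(\sum_{j=1}^d b_jn_j^{-s}\big)=0$, where $\sigma_a$ denotes the abscissa of absolute convergence of a Dirichlet series. Let $\mathbb H_0=\{s\in\mathbb C:\operatorname{Re}s>0\}$, let $\overline{\mathbb H_0}=\{s\in\mathbb C:\operatorname{Re}s\ge0\}$, and let $\mathbb B_d$ be the open unit ball of $\mathbb C^d$ (of $\ell^2$ if $d=\infty$). Put $$f_{\mathbf b,\mathbf n}(s)=\big(\sqrt{b_j}\,n_j^{-s}\big)_{j=1}^d,\qquad s\in\overline{\mathbb H_0},$$ which maps $\mathbb H_0$ into $\mathbb B_d$. Let $H^2_d$ be the Drury–Arveson space, that is, the reproducing kernel Hilbert space on $\mathbb B_d$ with kernel $\frac{1}{1-\langle z,w\rangle}$, let $\mathcal M(H^2_d)$ be the set of its multipliers (the functions $g:\mathbb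 B_d\to\mathbb C$ with $gh\in H^2_d$ for all $h\in H^2_d$), and let $$V=\{z\in\mathbb B_d:\ g(z)=0\text{ for all }g\in\mathcal M(H^2_d)\text{ that vanish on }f_{\mathbf b,\mathbf n}(\mathbb H_0)\}$$ be the multiplier variety associated with the kernel $K_{\mathbf b,\mathbf n}(s,u)=\big(1-\sum_{j=1}^d b_jn_j^{-s-\overline u}\big)^{-1}$ on $\mathbb H_0$. Assume that for every $i=2,\dots,d$ (every $i\ge2$ if $d=\infty$) the set $\{\ln n_1,\ln n_i\}$ is linearly dependent over $\mathbb Q$. (i) If $\sum_{j=1}^d b_j=1$, then $V=f_{\mathbf b,\mathbf n}(\mathbb H_0)\cup\{0\}$. (ii) If instead $\sum_{j=1}^d b_j<1$ and $\sigma_a\big(\sum_{j=1}^d b_jn_j^{-s}\big)=0$, then $V=f_{\mathbf b,\mathbf n}(\overline{\mathbb H_0})\cup\{0\}$. -/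

import Mathlib

open scoped ComplexOrder

noncomputable section

/-- The index set `{1, 2, …, d}` of a `d`-tuple, for `d ∈ ℕ ∪ {∞}` (all of `{1, 2, …}` if `d = ∞`). -/
abbrev TupleIndex (d : ℕ∞) : Type := {j : ℕ // 1 ≤ j ∧ (j : ℕ∞) ≤ d}

/-- The first index of a `d`-tuple with `d ≥ 2`. -/
def TupleIndex.first {d : ℕ∞} (hd : 2 ≤ d) : TupleIndex d :=
  ⟨1, le_rfl, le_trans (by norm_num) hd⟩

/-- The Hilbert space `ℓ²(ι)`; it is `ℂ^d` with the Euclidean norm if `ι` has `d < ∞` elements. -/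
abbrev EllTwo (ι : Type*) : Type _ := lp (fun _ : ι => ℂ) 2

/-- The open unit ball of `ℓ²(ι)`, as a type. -/
abbrev UnitBall (ι : Type*) : Type _ := ↥(Metric.ball (0 : EllTwo ι) 1)

/-- The scalar kernel `1 / (1 - ⟨z, w⟩)` on the unit ball, where `⟨z, w⟩ = ∑ j, z j * conj (w j)`.
Mathlib's inner product is conjugate linear in the first variable, whence the order `w, z`. -/
def druryArvesonScalar (ι : Type*) (z w : UnitBall ι) : ℂ :=
  1 / (1 - inner ℂ (w : EllTwo ι) (z : EllTwo ι))

/-- The Drury-Arveson kernel, in the format of Mathlib's (operator valued) kernels: the entry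
at `(z, w)` is multiplication by `1 / (1 - ⟨z, w⟩)` on `ℂ`. -/
def druryArvesonKernel (ι : Type*) : Matrix (UnitBall ι) (UnitBall ι) (ℂ →L[ℂ] ℂ) :=
  Matrix.of fun z w => druryArvesonScalar ι z w • ContinuousLinearMap.id ℂ ℂ

theorem norm_inner_unitBall_lt_one {ι : Type*} (z w : UnitBall ι) :
    ‖inner ℂ (w : EllTwo ι) (z : EllTwo ι)‖ < 1 := by
  have hz : ‖(z : EllTwo ι)‖ < 1 := mem_ball_zero_iff.mp z.2
  have hw : ‖(w : EllTwo ι)‖ < 1 := mem_ball_zero_iff.mp w.2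
  calc ‖inner ℂ (w : EllTwo ι) (z : EllTwo ι)‖ ≤ ‖(w : EllTwo ι)‖ * ‖(z : EllTwo ι)‖ :=
        norm_inner_le_norm _ _
    _ < 1 := by nlinarith [norm_nonneg (z : EllTwo ι), norm_nonneg (w : EllTwo ι)]

/-- The matrix of the `m`-th powers of the inner products is positive semidefinite. -/
theorem posSemidef_inner_pow (ι : Type*) (m : ℕ) :
    (Matrix.of fun z w : UnitBall ι =>
      (inner ℂ (w : EllTwo ι) (z : EllTwo ι)) ^ m).PosSemidef := by
  induction m with
  | zero =>
    refine ⟨by ext; simp, fun v => ?_⟩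
    have e : (v.sum fun x a => v.sum fun y c => star a * (Matrix.of fun z w : UnitBall ι =>
        (inner ℂ (w : EllTwo ι) (z : EllTwo ι)) ^ 0) x y * c) =
        star (v.sum fun _ a => a) * (v.sum fun _ a => a) := by
      simp [Finsupp.sum, Finset.sum_mul, Finset.mul_sum]
      exact Finset.sum_comm
    rw [e]
    exact star_mul_self_nonneg _
  | succ k ih =>
    have hgram : (Matrix.of fun z w : UnitBall ι =>
        inner ℂ (w : EllTwo ι) (z : EllTwo ι)).PosSemidef := by
      refine ⟨by ext; simp, fun v => ?_⟩
      have e : (v.sum fun x a => v.sum fun y c => star a * (Matrix.of fun z w : UnitBall ι =>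
          inner ℂ (w : EllTwo ι) (z : EllTwo ι)) x y * c) =
          inner ℂ (v.sum fun x a => star a • (x : EllTwo ι))
            (v.sum fun x a => star a • (x : EllTwo ι)) := by
        simp only [Finsupp.sum, sum_inner, inner_sum, inner_smul_left, inner_smul_right]
        refine Finset.sum_congr rfl fun x _ => ?_
        rw [Finset.mul_sum]
        refine Finset.sum_congr rfl fun y _ => ?_
        simp
        ring
      rw [e, inner_self_eq_norm_sq_to_K]
      positivity
    have h := ih.hadamard hgram
    have e : Matrix.hadamard (Matrix.of fun z w : UnitBall ι =>
        (inner ℂ (w : EllTwo ι) (z : EllTwo ι)) ^ k)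
        (Matrix.of fun z w : UnitBall ι => inner ℂ (w : EllTwo ι) (z : EllTwo ι)) =
        (Matrix.of fun z w : UnitBall ι =>
      (inner ℂ (w : EllTwo ι) (z : EllTwo ι)) ^ (k + 1)) := by
      ext i j; simp [Matrix.hadamard, pow_succ]
    rwa [e] at h

/-- The Drury-Arveson kernel is positive semidefinite. -/
theorem posSemidef_druryArvesonKernel (ι : Type*) : (druryArvesonKernel ι).PosSemidef := by
  have key : (druryArvesonKernel ι).IsHermitian ∧ ∀ (v : UnitBall ι →₀ ℂ),
      0 ≤ RCLike.re (v.sum fun x a => v.sum fun y c =>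
        inner ℂ (druryArvesonKernel ι y x a) c) := by
    refine ⟨?_, fun v => ?_⟩
    · ext z w
      have e : ContinuousLinearMap.adjoint (ContinuousLinearMap.id ℂ ℂ) =
          ContinuousLinearMap.id ℂ ℂ := ContinuousLinearMap.adjoint_id
      simp [druryArvesonKernel, druryArvesonScalar, ContinuousLinearMap.star_eq_adjoint, e]
    · have hterm : ∀ m : ℕ, 0 ≤ (v.sum fun x a => v.sum fun y c =>
          star a * (inner ℂ (y : EllTwo ι) (x : EllTwo ι)) ^ m * c).re := by
        intro m
        exact (Complex.le_def.mp ((posSemidef_inner_pow ι m).2 v)).1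
      have hsum : HasSum (fun m : ℕ => (v.sum fun x a => v.sum fun y c =>
          star a * (inner ℂ (y : EllTwo ι) (x : EllTwo ι)) ^ m * c))
          (v.sum fun x a => v.sum fun y c =>
            inner ℂ (druryArvesonKernel ι y x a) c) := by
        refine hasSum_sum fun x _ => hasSum_sum fun y _ => ?_
        have h := hasSum_geometric_of_norm_lt_one (norm_inner_unitBall_lt_one x y)
        have h2 := (h.mul_left (star (v x))).mul_right (v y)
        have e : inner ℂ (druryArvesonKernel ι y x (v x)) (v y) =
            star (v x) * (1 - inner ℂ (y : EllTwo ι) (x : EllTwo ι))⁻¹ * v y := by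
          simp [druryArvesonKernel, druryArvesonScalar]
          ring
        change HasSum _ (inner ℂ (druryArvesonKernel ι y x (v x)) (v y))
        rw [e]
        exact h2
      exact (Complex.hasSum_re hsum).nonneg hterm
  exact (RKHS.posSemidef_tfae.out 0 2).mpr key

instance (ι : Type*) : Fact (druryArvesonKernel ι).PosSemidef :=
  ⟨posSemidef_druryArvesonKernel ι⟩

/-- The Drury-Arveson space `H²_d`: the reproducing kernel Hilbert space of functions on the unit
ball whose kernel is the Drury-Arveson kernel. -/
abbrev DruryArvesonSpace (ι : Type*) : Type _ := RKHS.OfKernel (druryArvesonKernel ι)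

/-- `φ : X → ℂ` is a multiplier of the reproducing kernel Hilbert space `H` of functions on `X` if
`φ h ∈ H` for every `h ∈ H`. -/
def IsMultiplier {X : Type*} (H : Type*) [NormedAddCommGroup H] [InnerProductSpace ℂ H]
    [RKHS ℂ H X ℂ] (φ : X → ℂ) : Prop :=
  ∀ h : H, ∃ k : H, ∀ x : X, k x = φ x * h x

/-- The set of common zeros, in the unit ball of `ℓ²(ι)`, of all multipliers of the Drury-Arveson
space that vanish on `S`. -/
def multiplierHull {ι : Type*} (S : Set (EllTwo ι)) : Set (EllTwo ι) :=
  {z | ∃ hz : z ∈ Metric.ball (0 : EllTwo ι) 1, ∀ g : UnitBall ι → ℂ,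
    IsMultiplier (DruryArvesonSpace ι) g →
      (∀ w : UnitBall ι, (w : EllTwo ι) ∈ S → g w = 0) → g ⟨z, hz⟩ = 0}

/-- The abscissa of absolute convergence of the Dirichlet series `∑ j, b j * (n j) ^ (-s)`, for
distinct `n j`; its coefficient at `N` is `b j` if `N = n j`, and `0` if `N` is none of the `n j`. -/
def abscissa {ι : Type*} (b : ι → ℝ) (n : ι → ℕ) : EReal :=
  LSeries.abscissaOfAbsConv (Function.extend n (fun j => (b j : ℂ)) 0)

/-- The standing assumption on the weights `b` and the frequencies `n`. -/
structure IsAdmissible {ι : Type*} (b : ι → ℝ) (n : ι → ℕ) : Prop where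
  injective : Function.Injective n
  two_le : ∀ j, 2 ≤ n j
  pos : ∀ j, 0 < b j
  sum : HasSum b 1 ∨ (Summable b ∧ ∑' j, b j < 1 ∧ abscissa b n = 0)

namespace IsAdmissible

variable {ι : Type*} {b : ι → ℝ} {n : ι → ℕ}

theorem summable (h : IsAdmissible b n) : Summable b :=
  h.sum.elim HasSum.summable fun h' => h'.1

theorem tsum_le_one (h : IsAdmissible b n) : ∑' j, b j ≤ 1 :=
  h.sum.elim (fun h' => h'.tsum_eq.le) fun h' => h'.2.1.le

theorem norm_sq_coord (h : IsAdmissible b n) (s : ℂ) (j : ι) :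
    ‖(√(b j) : ℂ) * (n j : ℂ) ^ (-s)‖ ^ 2 = b j * (n j : ℝ) ^ (-(2 * s.re)) := by
  have hn : 0 < n j := lt_of_lt_of_le two_pos (h.two_le j)
  have hn' : (0 : ℝ) ≤ n j := Nat.cast_nonneg _
  rw [norm_mul, Complex.norm_natCast_cpow_of_pos hn, Complex.norm_real, Real.norm_eq_abs,
    abs_of_nonneg (Real.sqrt_nonneg _), mul_pow, Real.sq_sqrt (h.pos j).le, Complex.neg_re,
    ← Real.rpow_natCast _ 2, ← Real.rpow_mul hn']
  congr 2
  push_cast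
  ring

theorem norm_sq_coord_le (h : IsAdmissible b n) {s : ℂ} (hs : 0 ≤ s.re) (j : ι) :
    ‖(√(b j) : ℂ) * (n j : ℂ) ^ (-s)‖ ^ 2 ≤ b j := by
  rw [h.norm_sq_coord]
  have h1 : (1 : ℝ) ≤ n j := by exact_mod_cast le_trans one_le_two (h.two_le j)
  have := Real.rpow_le_one_of_one_le_of_nonpos h1 (show -(2 * s.re) ≤ 0 by linarith)
  exact mul_le_of_le_one_right (h.pos j).le this

theorem memℓp_coord (h : IsAdmissible b n) {s : ℂ} (hs : 0 ≤ s.re) :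
    Memℓp (fun j => (√(b j) : ℂ) * (n j : ℂ) ^ (-s)) 2 := by
  refine memℓp_gen ?_
  simp only [ENNReal.toReal_ofNat, Real.rpow_ofNat]
  exact Summable.of_nonneg_of_le (fun j => sq_nonneg _) (h.norm_sq_coord_le hs) h.summable

/-- The map `s ↦ (√(b j) * (n j) ^ (-s))_j`, on the closed right half-plane, with values
in `ℓ²(ι)`. -/
def curve (h : IsAdmissible b n) (s : {s : ℂ // 0 ≤ s.re}) : EllTwo ι :=
  ⟨fun j => (√(b j) : ℂ) * (n j : ℂ) ^ (-(s : ℂ)), h.memℓp_coord s.2⟩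

/-- The open right half-plane is mapped into the open unit ball. -/
theorem curve_image_subset_ball [Nonempty ι] (h : IsAdmissible b n) :
    h.curve '' {s | 0 < (s : ℂ).re} ⊆ Metric.ball 0 1 := by
  rintro _ ⟨s, hs, rfl⟩
  have hs' : 0 < (s : ℂ).re := hs
  rw [mem_ball_zero_iff]
  have e : ‖h.curve s‖ ^ 2 = ∑' j, ‖(√(b j) : ℂ) * (n j : ℂ) ^ (-(s : ℂ))‖ ^ 2 := by
    have := lp.norm_rpow_eq_tsum (p := 2) (by norm_num) (h.curve s)
    simpa [curve] using this
  have hlt : ∑' j, ‖(√(b j) : ℂ) * (n j : ℂ) ^ (-(s : ℂ))‖ ^ 2 < ∑' j, b j := by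
    obtain ⟨j⟩ := ‹Nonempty ι›
    refine Summable.tsum_lt_tsum (i := j) (h.norm_sq_coord_le s.2) ?_
      (Summable.of_nonneg_of_le (fun j => sq_nonneg _) (h.norm_sq_coord_le s.2) h.summable)
      h.summable
    rw [h.norm_sq_coord]
    have h1 : (1 : ℝ) < n j := by exact_mod_cast lt_of_lt_of_le one_lt_two (h.two_le j)
    have := Real.rpow_lt_one_of_one_lt_of_neg h1 (show -(2 * (s : ℂ).re) < 0 by linarith)
    exact mul_lt_of_lt_one_right (h.pos j) this
  have := h.tsum_le_one
  nlinarith [norm_nonneg (h.curve s)]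

/-- The multiplier variety: the points `z` of the unit ball such that `g z = 0` for every
multiplier `g` of the Drury-Arveson space that vanishes on the image of the open right
half-plane. -/
def multiplierVariety (h : IsAdmissible b n) : Set (EllTwo ι) :=
  multiplierHull (h.curve '' {s | 0 < (s : ℂ).re})

end IsAdmissible

end

/-! Rescaled by `(√b_j)⁻¹`, the curve is `s ↦ (exp(-s log n_j))_j`. Commensurability makes the group
generated by the `log n_j` cyclic with generator `g > 0`, so `log n_j = k_j g` with `k_j ≥ 1`, and
the curve is the monomial curve `(l ^ k_j)_j` with `l = exp(-g s)`.

Upper bound: coordinates are multipliers (`isMultiplier_coord`), hence so are polynomials, and every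
monomial relation of the curve holds on the variety. These relations force a point to be `0` or of
the form `(√b_j n_j^(-s))_j` for some complex `s` (`eq_zero_or_exists_eq_exp`). Lying in the unit
ball then means `∑ b_j n_j^(-2 Re s) < 1`: if `∑ b_j = 1` this forces `Re s > 0`, and if the
abscissa is `0`, convergence alone forces `Re s ≥ 0`.

Lower bound: multipliers are continuous, so the variety contains every limit of curve points that
stays in the ball. The origin is the limit as `Re s → ∞`; when `∑ b_j < 1`, the imaginary axis also
lands inside the ball. -/

open scoped ComplexConjugate
open Filter Topology

/-! ### Algebra of multipliers. -/

namespace IsMultiplier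

variable {X H : Type*} [NormedAddCommGroup H] [InnerProductSpace ℂ H] [RKHS ℂ H X ℂ]
  {φ ψ : X → ℂ}

theorem const (c : ℂ) : IsMultiplier H (fun _ : X => c) := fun h =>
  ⟨c • h, fun x => by simp⟩

theorem mul (hφ : IsMultiplier H φ) (hψ : IsMultiplier H ψ) :
    IsMultiplier H (fun x => φ x * ψ x) := fun h => by
  obtain ⟨k, hk⟩ := hψ h
  obtain ⟨l, hl⟩ := hφ k
  exact ⟨l, fun x => by rw [hl, hk, mul_assoc]⟩

theorem sub (hφ : IsMultiplier H φ) (hψ : IsMultiplier H ψ) :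
    IsMultiplier H (fun x => φ x - ψ x) := fun h => by
  obtain ⟨k, hk⟩ := hφ h
  obtain ⟨l, hl⟩ := hψ h
  exact ⟨k - l, fun x => by simp [hk, hl, sub_mul]⟩

theorem pow (hφ : IsMultiplier H φ) (m : ℕ) : IsMultiplier H (fun x => φ x ^ m) := by
  induction m with
  | zero => simpa using const (H := H) (X := X) 1
  | succ m ih => simpa only [pow_succ] using ih.mul hφ

theorem finset_prod {α : Type*} (s : Finset α) {φ : α → X → ℂ}
    (hφ : ∀ a ∈ s, IsMultiplier H (φ a)) : IsMultiplier H (fun x => ∏ a ∈ s, φ a x) := by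
  classical
  induction s using Finset.induction_on with
  | empty => simpa using const (H := H) (X := X) 1
  | insert a s ha ih =>
    simp only [Finset.prod_insert ha]
    exact (hφ a (by simp)).mul (ih fun c hc => hφ c (by simp [hc]))

end IsMultiplier

/-! ### A positivity criterion for multipliers. -/

namespace RKHS

variable {X : Type*} (H : Type*) [NormedAddCommGroup H] [InnerProductSpace ℂ H]
  [CompleteSpace H] [RKHS ℂ H X ℂ]

/-- Lets an operator prescribed on the kernel functions be extended to all of `H`. -/
theorem denseRange_linearCombination_kerFun :
    DenseRange (Finsupp.linearCombination ℂ fun x : X => kerFun H x 1) := by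
  have e : ((Finsupp.linearCombination ℂ fun x : X => kerFun H x 1).range : Submodule ℂ H) =
      Submodule.span ℂ {kerFun H x v | (x) (v)} := by
    rw [Finsupp.range_linearCombination]
    refine le_antisymm (Submodule.span_mono ?_) (Submodule.span_le.2 ?_)
    · rintro _ ⟨x, rfl⟩
      exact ⟨x, 1, rfl⟩
    · rintro _ ⟨x, v, rfl⟩
      have : kerFun H x v = v • kerFun H x 1 := by rw [← map_smul, smul_eq_mul, mul_one]
      rw [this]
      exact Submodule.smul_mem _ _ (Submodule.subset_span ⟨x, rfl⟩)
  have := kerFun_dense (𝕜 := ℂ) H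
  rw [← e, ← Submodule.dense_iff_topologicalClosure_eq_top] at this
  simpa [DenseRange] using! this

variable {H}

/-- If `(1 - φ(x) conj φ(y)) K(x, y)` is positive semidefinite, then `φ` is a multiplier. -/
theorem isMultiplier_of_posSemidef {φ : X → ℂ}
    (h : (Matrix.of fun x y : X => (1 - φ x * conj (φ y)) *
      inner ℂ (kerFun H x 1) (kerFun H y 1)).PosSemidef) : IsMultiplier H φ := by
  set L := Finsupp.linearCombination ℂ fun x : X => kerFun H x 1 with hL
  set S := Finsupp.linearCombination ℂ fun x : X => conj (φ x) • kerFun H x 1 with hS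
  -- The quadratic form of the given matrix at `v` is `‖L v‖² - ‖S v‖²`, so `L v ↦ S v` is a
  -- well-defined contraction.
  have hbound : ∀ v, ‖S v‖ ≤ 1 * ‖L v‖ := by
    intro v
    rw [one_mul]
    refine le_of_sq_le_sq ?_ (norm_nonneg _)
    have h1 := (Complex.le_def.1 (h.2 v)).1
    have e : (v.sum fun i xi => v.sum fun j xj => star xi * (Matrix.of fun x y : X =>
        (1 - φ x * conj (φ y)) * inner ℂ (kerFun H x 1) (kerFun H y 1)) i j * xj) =
        inner ℂ (L v) (L v) - inner ℂ (S v) (S v) := by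
      simp only [hL, hS, Finsupp.linearCombination_apply, Finsupp.sum, sum_inner, inner_sum,
        inner_smul_left, inner_smul_right, Finset.mul_sum, ← Finset.sum_sub_distrib]
      rw [Finset.sum_comm]
      refine Finset.sum_congr rfl fun x _ => Finset.sum_congr rfl fun y _ => ?_
      simp only [Matrix.of_apply, RCLike.star_def, RingHomCompTriple.comp_apply, RingHom.id_apply]
      ring
    rw [e, inner_self_eq_norm_sq_to_K, inner_self_eq_norm_sq_to_K] at h1
    simpa [← Complex.ofReal_pow] using h1
  set T := S.extendOfNorm L with hT
  have hTK : ∀ x, T (kerFun H x 1) = conj (φ x) • kerFun H x 1 := by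
    intro x
    have := LinearMap.extendOfNorm_eq (denseRange_linearCombination_kerFun H) ⟨1, hbound⟩
      (Finsupp.single x 1)
    simpa [hL, hS] using this
  intro f
  -- The kernel functions are eigenvectors of `T`, so by the reproducing property its adjoint is
  -- multiplication by `φ`.
  refine ⟨T.adjoint f, fun x => ?_⟩
  have h1 := kerFun_inner (𝕜 := ℂ) x 1 (T.adjoint f)
  rw [ContinuousLinearMap.adjoint_inner_right, hTK, inner_smul_left, kerFun_inner] at h1
  simpa using h1.symm

end RKHS

theorem posSemidef_inner {α E : Type*} [NormedAddCommGroup E] [InnerProductSpace ℂ E]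
    (v : α → E) : (Matrix.of fun x y => inner ℂ (v x) (v y)).PosSemidef := by
  refine ⟨by ext; simp, fun a => ?_⟩
  have e : (a.sum fun x c => a.sum fun y c' => star c * (Matrix.of fun x y =>
      inner ℂ (v x) (v y)) x y * c') =
      inner ℂ (a.sum fun x c => c • v x) (a.sum fun x c => c • v x) := by
    simp only [Finsupp.sum, sum_inner, inner_sum, inner_smul_left, inner_smul_right,
      Finset.mul_sum]
    rw [Finset.sum_comm]
    refine Finset.sum_congr rfl fun x _ => Finset.sum_congr rfl fun y _ => ?_
    simp
    ring
  rw [e, inner_self_eq_norm_sq_to_K]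
  positivity

/-! ### Coordinates and continuity in the Drury-Arveson space. -/

namespace DruryArvesonSpace

variable {ι : Type*}

theorem inner_kerFun_kerFun (z w : UnitBall ι) :
    inner ℂ (RKHS.kerFun (DruryArvesonSpace ι) z 1) (RKHS.kerFun (DruryArvesonSpace ι) w 1) =
      druryArvesonScalar ι z w := by
  rw [RKHS.kerFun_inner, RKHS.kerFun_apply, RKHS.OfKernel.kernel_ofKernel]
  simp [druryArvesonKernel]

/-- With `K = 1 / (1 - ⟨z, w⟩)`, one has `(1 - z_j conj w_j) K = 1 + (⟨z, w⟩ - z_j conj w_j) K`. The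
bracket is the Gram matrix of the points with coordinate `j` deleted, so the Schur product theorem
gives positivity. -/
theorem isMultiplier_coord (j : ι) :
    IsMultiplier (DruryArvesonSpace ι) fun z : UnitBall ι => (z : EllTwo ι) j := by
  classical
  refine RKHS.isMultiplier_of_posSemidef ?_
  have hK := posSemidef_inner fun z : UnitBall ι => RKHS.kerFun (DruryArvesonSpace ι) z 1
  have hA := (posSemidef_inner fun z : UnitBall ι =>
    (z : EllTwo ι) - lp.single 2 j ((z : EllTwo ι) j)).transpose
  have h1 := posSemidef_inner fun _ : UnitBall ι => (1 : ℂ)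
  convert h1.add (hA.hadamard hK) using 1
  ext z w
  simp only [Matrix.add_apply, Matrix.hadamard_apply, Matrix.of_apply, Matrix.transpose_apply,
    inner_kerFun_kerFun, druryArvesonScalar, inner_sub_left, inner_sub_right,
    lp.inner_single_left, lp.inner_single_right, lp.single_apply_self]
  have hne : 1 - inner ℂ (w : EllTwo ι) (z : EllTwo ι) ≠ 0 := fun h0 => by
    have := norm_inner_unitBall_lt_one z w
    rw [← sub_eq_zero.1 h0] at this
    simp at this
  simp
  field_simp
  ring

/-- Functions in the Drury-Arveson space are continuous. -/
theorem continuous_coe (f : DruryArvesonSpace ι) : Continuous fun z : UnitBall ι => f z := by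
  have hK : Continuous fun p : UnitBall ι × UnitBall ι => druryArvesonScalar ι p.1 p.2 := by
    unfold druryArvesonScalar
    refine continuous_const.div (by fun_prop) fun p h0 => ?_
    have := norm_inner_unitBall_lt_one p.1 p.2
    rw [← sub_eq_zero.1 h0] at this
    simp at this
  have hc : Continuous fun z : UnitBall ι => RKHS.kerFun (DruryArvesonSpace ι) z 1 := by
    refine continuous_iff_continuousAt.2 fun z => ?_
    rw [ContinuousAt, tendsto_iff_norm_sub_tendsto_zero]
    have hsq : ∀ w : UnitBall ι, ‖RKHS.kerFun (DruryArvesonSpace ι) w 1 -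
        RKHS.kerFun (DruryArvesonSpace ι) z 1‖ ^ 2 = (druryArvesonScalar ι w w -
        druryArvesonScalar ι w z - (druryArvesonScalar ι z w - druryArvesonScalar ι z z)).re := by
      intro w
      simp only [← inner_kerFun_kerFun, ← inner_sub_right, ← inner_sub_left]
      rw [← inner_self_eq_norm_sq (𝕜 := ℂ)]
      rfl
    have h0 : Tendsto (fun w : UnitBall ι => (druryArvesonScalar ι w w -
        druryArvesonScalar ι w z - (druryArvesonScalar ι z w - druryArvesonScalar ι z z)).re)
        (𝓝 z) (𝓝 0) := by
      have hcont : Continuous fun w : UnitBall ι => (druryArvesonScalar ι w w -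
          druryArvesonScalar ι w z -
          (druryArvesonScalar ι z w - druryArvesonScalar ι z z)).re := by
        have h1 := hK.comp (continuous_id.prodMk continuous_id)
        have h2 := hK.comp (continuous_id.prodMk (continuous_const (y := z)))
        have h3 := hK.comp ((continuous_const (y := z)).prodMk continuous_id)
        exact Complex.continuous_re.comp ((h1.sub h2).sub (h3.sub continuous_const))
      simpa using hcont.tendsto z
    have := h0.sqrt
    simp only [← hsq, Real.sqrt_sq (norm_nonneg _), Real.sqrt_zero] at this
    exact this
  have e : (fun z : UnitBall ι => f z) =
      fun z => inner ℂ (RKHS.kerFun (DruryArvesonSpace ι) z 1) f := by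
    ext z
    simp
  rw [e]
  exact hc.inner continuous_const

/-- Multipliers of the Drury-Arveson space are continuous. -/
theorem _root_.IsMultiplier.continuous {g : UnitBall ι → ℂ}
    (hg : IsMultiplier (DruryArvesonSpace ι) g) : Continuous g := by
  -- The kernel function at the origin is the constant `1`, so `g` itself lies in the space.
  obtain ⟨k, hk⟩ := hg (RKHS.kerFun (DruryArvesonSpace ι) ⟨0, by simp⟩ 1)
  have e : g = fun z => k z := by
    ext z
    rw [hk, RKHS.kerFun_apply, RKHS.OfKernel.kernel_ofKernel]
    simp [druryArvesonKernel, druryArvesonScalar]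
  rw [e]
  exact continuous_coe k

end DruryArvesonSpace

/-! ### Groups generated by commensurable logarithms. -/

/-- Some positive power of `r` is a power of the integer `a`, so `r` is itself an integer, and being
greater than `1` it is at least `2`. -/
theorem Real.log_two_le_of_log_eq_ratCast_mul_log {r c : ℚ} {a : ℕ} (hr : 0 < r) (ha : 2 ≤ a)
    (h : Real.log r = c * Real.log a) (hpos : 0 < Real.log r) : Real.log 2 ≤ Real.log r := by
  have ha0 : (0 : ℝ) < a := by exact_mod_cast lt_of_lt_of_le two_pos ha
  have hla : 0 < Real.log a := Real.log_pos (by exact_mod_cast lt_of_lt_of_le one_lt_two ha)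
  have hc : 0 < c := by
    have : (0 : ℝ) < c := by
      by_contra! hc
      nlinarith
    exact_mod_cast this
  obtain ⟨p, hp⟩ := Int.eq_ofNat_of_zero_le (Rat.num_pos.2 hc).le
  have hcq : (c : ℝ) * c.den = p := by
    have := Rat.mul_den_eq_num c
    rw [hp] at this
    exact_mod_cast this
  have hpow : r ^ c.den = (a : ℚ) ^ p := by
    have hr' : (0 : ℝ) < r := by exact_mod_cast hr
    have : (r : ℝ) ^ c.den = (a : ℝ) ^ p := by
      refine Real.log_injOn_pos (pow_pos hr' _) (pow_pos ha0 _) ?_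
      rw [Real.log_pow, Real.log_pow, h, ← hcq]
      ring
    exact_mod_cast this
  have hden : r.den = 1 := by
    have h1 : r.den ^ c.den = 1 := by
      rw [← Rat.den_pow, hpow, ← Nat.cast_pow, Rat.den_natCast]
    exact (Nat.pow_eq_one.1 h1).resolve_right c.den_ne_zero
  have h1 : (1 : ℝ) < r := by
    by_contra! h1
    exact absurd (Real.log_nonpos (by exact_mod_cast hr.le) h1) hpos.not_ge
  have h2 : (2 : ℚ) ≤ r := by
    have h1' : (1 : ℚ) < r := by exact_mod_cast h1
    have e := (Rat.den_eq_one_iff r).1 hden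
    rw [← e] at h1' ⊢
    have : (1 : ℤ) < r.num := by exact_mod_cast h1'
    exact_mod_cast (show (2 : ℤ) ≤ r.num by omega)
  exact Real.log_le_log two_pos (by exact_mod_cast h2)

/-- Pairwise commensurable logarithms of integers generate a cyclic group. -/
theorem exists_closure_log_eq_zmultiples {ι : Type*} (n : ι → ℕ) (hn : ∀ j, 2 ≤ n j) (i₀ : ι)
    (hdep : ∀ j, ∃ c : ℚ, Real.log (n j) = c * Real.log (n i₀)) :
    ∃ g : ℝ, 0 < g ∧ g ∈ AddSubgroup.closure (Set.range fun j => Real.log (n j)) ∧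
      ∀ j, ∃ k : ℕ, 0 < k ∧ Real.log (n j) = k * g := by
  set G := AddSubgroup.closure (Set.range fun j => Real.log (n j)) with hG
  have hlog : ∀ j, 0 < Real.log (n j) := fun j =>
    Real.log_pos (by exact_mod_cast lt_of_lt_of_le one_lt_two (hn j))
  have hmem : ∀ j, Real.log (n j) ∈ G := fun j => AddSubgroup.subset_closure ⟨j, rfl⟩
  -- Both descriptions are needed: together they keep `G` out of `(0, log 2)`, and a subgroup of `ℝ`
  -- with such a gap is cyclic.
  have hform : ∀ x ∈ G, (∃ r : ℚ, 0 < r ∧ x = Real.log r) ∧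
      ∃ c : ℚ, x = c * Real.log (n i₀) := by
    intro x hx
    induction hx using AddSubgroup.closure_induction with
    | mem x hx =>
      obtain ⟨j, rfl⟩ := hx
      exact ⟨⟨n j, by exact_mod_cast lt_of_lt_of_le two_pos (hn j), by simp⟩, hdep j⟩
    | zero => exact ⟨⟨1, one_pos, by simp⟩, 0, by simp⟩
    | add x y _ _ hx hy =>
      obtain ⟨⟨r, hr, e⟩, c, e'⟩ := hx
      obtain ⟨⟨r₂, hr₂, e₂⟩, c₂, e₂'⟩ := hy
      refine ⟨⟨r * r₂, mul_pos hr hr₂, ?_⟩, c + c₂, ?_⟩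
      · rw [e, e₂, Rat.cast_mul, Real.log_mul (by exact_mod_cast hr.ne') (by exact_mod_cast hr₂.ne')]
      · rw [e', e₂', Rat.cast_add, add_mul]
    | neg x _ hx =>
      obtain ⟨⟨r, hr, e⟩, c, e'⟩ := hx
      exact ⟨⟨r⁻¹, inv_pos.2 hr, by rw [e, Rat.cast_inv, Real.log_inv]⟩, -c, by simp [e']⟩
  have hdisj : Disjoint (G : Set ℝ) (Set.Ioo 0 (Real.log 2)) := by
    refine Set.disjoint_left.2 fun x hx hx' => ?_
    obtain ⟨⟨r, hr, rfl⟩, c, hc⟩ := hform x hx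
    exact absurd (Real.log_two_le_of_log_eq_ratCast_mul_log hr (hn i₀) hc hx'.1) hx'.2.not_ge
  obtain ⟨g, hg⟩ := AddSubgroup.cyclic_of_isolated_zero (Real.log_pos one_lt_two) hdisj
  rw [← AddSubgroup.zmultiples_eq_closure] at hg
  have hgG : g ∈ G := hg ▸ AddSubgroup.mem_zmultiples g
  have hmul : ∀ j, ∃ k : ℤ, Real.log (n j) = k * g := by
    intro j
    obtain ⟨k, hk⟩ := AddSubgroup.mem_zmultiples_iff.1 (hg ▸ hmem j)
    exact ⟨k, by simpa using hk.symm⟩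
  have hg0 : g ≠ 0 := by
    rintro rfl
    obtain ⟨k, hk⟩ := hmul i₀
    have := hlog i₀
    simp [hk] at this
  have habs : |g| ∈ G ∧ ∀ j, ∃ k : ℤ, Real.log (n j) = k * |g| := by
    rcases abs_choice g with e | e
    · rw [e]
      exact ⟨hgG, hmul⟩
    · rw [e]
      exact ⟨G.neg_mem hgG, fun j => (hmul j).imp' (fun k => -k) fun k hk => by simp [hk]⟩
  refine ⟨|g|, abs_pos.2 hg0, habs.1, fun j => ?_⟩
  obtain ⟨k, hk⟩ := habs.2 j
  have hk0 : 0 < k := by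
    have h1 := hlog j
    rw [hk] at h1
    exact_mod_cast pos_of_mul_pos_left h1 (abs_nonneg g)
  lift k to ℕ using hk0.le
  exact ⟨k, by exact_mod_cast hk0, by exact_mod_cast hk⟩

/-! ### Monomial relations and the one-parameter orbit. -/

/-- The value at `w` of the monomial with exponents `p`. -/
noncomputable def monomialValue {ι : Type*} (w : ι → ℂ) (p : ι →₀ ℕ) : ℂ := p.prod fun j a => w j ^ a

section Monomial

variable {ι : Type*} (w : ι → ℂ)

theorem monomialValue_add (p q : ι →₀ ℕ) :
    monomialValue w (p + q) = monomialValue w p * monomialValue w q := by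
  classical
  exact Finsupp.prod_add_index' (by simp) (fun j a c => pow_add _ _ _)

theorem monomialValue_single (j : ι) (a : ℕ) :
    monomialValue w (Finsupp.single j a) = w j ^ a := by
  simp [monomialValue]

theorem monomialValue_nsmul (k : ℕ) (p : ι →₀ ℕ) :
    monomialValue w (k • p) = monomialValue w p ^ k := by
  induction k with
  | zero => simp [monomialValue]
  | succ k ih => rw [succ_nsmul, monomialValue_add, ih, pow_succ]

theorem monomialValue_ne_zero (hw : ∀ j, w j ≠ 0) (p : ι →₀ ℕ) : monomialValue w p ≠ 0 :=
  Finset.prod_ne_zero_iff.2 fun j _ => pow_ne_zero _ (hw j)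

/-- On the orbit a monomial depends only on its total weight; this is the source of the relations.
-/
theorem monomialValue_exp (L : ι → ℝ) (s : ℂ) (p : ι →₀ ℕ) :
    monomialValue (fun j => Complex.exp (L j * s)) p =
      Complex.exp ((Finsupp.linearCombination ℕ L p : ℝ) * s) := by
  simp only [monomialValue, Finsupp.prod, ← Complex.exp_nat_mul, ← Complex.exp_sum,
    Finsupp.linearCombination_apply, Finsupp.sum]
  congr 1
  push_cast
  rw [Finset.sum_mul]
  simp [mul_assoc]

theorem exists_sub_linearCombination_of_mem_closure {L : ι → ℝ} {x : ℝ}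
    (hx : x ∈ AddSubgroup.closure (Set.range L)) : ∃ p q : ι →₀ ℕ,
      x = Finsupp.linearCombination ℕ L p - Finsupp.linearCombination ℕ L q := by
  induction hx using AddSubgroup.closure_induction with
  | mem x hx =>
    obtain ⟨j, rfl⟩ := hx
    exact ⟨Finsupp.single j 1, 0, by simp⟩
  | zero => exact ⟨0, 0, by simp⟩
  | add x y _ _ hx hy =>
    obtain ⟨p, q, e⟩ := hx
    obtain ⟨p', q', e'⟩ := hy
    exact ⟨p + p', q + q', by simp only [e, e', map_add]; ring⟩
  | neg x _ hx =>
    obtain ⟨p, q, e⟩ := hx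
    exact ⟨q, p, by rw [e, neg_sub]⟩

variable {w}

/-- A point of the toric variety of a cyclic group of weights is the origin or lies on the
one-parameter orbit. -/
theorem eq_zero_or_exists_eq_exp {L : ι → ℝ} {g : ℝ} (hg : 0 < g)
    (hgL : g ∈ AddSubgroup.closure (Set.range L)) (hL : ∀ j, ∃ k : ℕ, 0 < k ∧ L j = k * g)
    (hw : ∀ p q : ι →₀ ℕ, Finsupp.linearCombination ℕ L p = Finsupp.linearCombination ℕ L q →
      monomialValue w p = monomialValue w q) :
    (∀ j, w j = 0) ∨ ∃ s : ℂ, ∀ j, w j = Complex.exp (L j * -s) := by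
  choose k hk0 hk using hL
  by_cases hne : ∀ j, w j = 0
  · exact Or.inl hne
  push Not at hne
  obtain ⟨i, hi⟩ := hne
  -- Equal weights `k_i L_j = k_j L_i` give `w_j ^ k_i = w_i ^ k_j`, so one nonzero coordinate makes
  -- all nonzero.
  have hall : ∀ j, w j ≠ 0 := by
    intro j hj
    have := hw (Finsupp.single j (k i)) (Finsupp.single i (k j)) (by simp [hk]; ring)
    rw [monomialValue_single, monomialValue_single, hj, zero_pow (hk0 i).ne'] at this
    exact pow_ne_zero _ hi this.symm
  obtain ⟨p, q, hpq⟩ := exists_sub_linearCombination_of_mem_closure hgL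
  have hq := monomialValue_ne_zero w hall q
  have hp := monomialValue_ne_zero w hall p
  -- A Laurent monomial of weight `g`: it plays the role of `exp(-g s)`, which dictates the choice
  -- of `s`. Clearing denominators in `w_j = l ^ k_j` gives an honest monomial relation.
  set l := monomialValue w p / monomialValue w q with hl
  have hl0 : l ≠ 0 := div_ne_zero hp hq
  refine Or.inr ⟨-(Complex.log l / g), fun j => ?_⟩
  have h1 := hw (Finsupp.single j 1 + k j • q) (k j • p) (by
    simp only [map_add, map_nsmul, Finsupp.linearCombination_single, one_smul, hk, nsmul_eq_mul]
    rw [hpq]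
    ring)
  rw [monomialValue_add, monomialValue_nsmul, monomialValue_nsmul, monomialValue_single,
    pow_one] at h1
  have hg' : (g : ℂ) ≠ 0 := by exact_mod_cast hg.ne'
  have e : (L j : ℂ) * - -(Complex.log l / g) = k j * Complex.log l := by
    rw [hk]
    push_cast
    field_simp
  rw [e, Complex.exp_nat_mul, Complex.exp_log hl0, hl, div_pow, eq_div_iff (pow_ne_zero _ hq), h1]

end Monomial

/-! ### Norms and convergence in `ℓ²`. -/

theorem EllTwo.norm_sq_eq_tsum {ι : Type*} (z : EllTwo ι) : ‖z‖ ^ 2 = ∑' j, ‖z j‖ ^ 2 := by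
  simpa using lp.norm_rpow_eq_tsum (p := 2) (by norm_num) z

theorem EllTwo.summable_norm_sq {ι : Type*} (z : EllTwo ι) : Summable fun j => ‖z j‖ ^ 2 := by
  simpa using (lp.memℓp z).summable (by norm_num)

/-- Dominated convergence in `ℓ²`. -/
theorem EllTwo.tendsto_of_dominated {ι α : Type*} {l : Filter α} {b : ι → ℝ} (hb : Summable b)
    {F : α → EllTwo ι} {z : EllTwo ι} (hF : ∀ a j, ‖F a j‖ ^ 2 ≤ b j) (hz : ∀ j, ‖z j‖ ^ 2 ≤ b j)
    (hlim : ∀ j, Tendsto (fun a => F a j) l (𝓝 (z j))) : Tendsto F l (𝓝 z) := by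
  rw [tendsto_iff_norm_sub_tendsto_zero]
  have h0 : Tendsto (fun a => ∑' j, ‖(F a - z) j‖ ^ 2) l (𝓝 (∑' _ : ι, (0 : ℝ))) := by
    -- The factor `4` comes from `(x + y)² ≤ 2x² + 2y²` with `x², y² ≤ b_j`.
    refine tendsto_tsum_of_dominated_convergence (bound := fun j => 4 * b j) (hb.mul_left 4)
      (fun j => ?_) (Eventually.of_forall fun a j => ?_)
    · have := ((hlim j).sub_const (z j)).norm.pow 2
      simpa using this
    · rw [Real.norm_eq_abs, abs_of_nonneg (sq_nonneg _)]
      have h1 : ‖(F a - z) j‖ ≤ ‖F a j‖ + ‖z j‖ := norm_sub_le _ _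
      nlinarith [hF a j, hz j, norm_nonneg ((F a - z) j), sq_nonneg (‖F a j‖ - ‖z j‖)]
  have := h0.sqrt
  simpa only [← EllTwo.norm_sq_eq_tsum, Real.sqrt_sq (norm_nonneg _), tsum_zero,
    Real.sqrt_zero] using this

/-! ### Points of the multiplier variety. -/

namespace IsAdmissible

variable {ι : Type*} {b : ι → ℝ} {n : ι → ℕ}

theorem natCast_pos (h : IsAdmissible b n) (j : ι) : 0 < n j :=
  lt_of_lt_of_le two_pos (h.two_le j)

theorem curve_apply (h : IsAdmissible b n) (s : {s : ℂ // 0 ≤ s.re}) (j : ι) :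
    h.curve s j = √(b j) * (n j : ℂ) ^ (-(s : ℂ)) := rfl

theorem natCast_cpow_eq_exp (h : IsAdmissible b n) (s : ℂ) (j : ι) :
    (n j : ℂ) ^ s = Complex.exp (Real.log (n j) * s) := by
  rw [Complex.cpow_def_of_ne_zero (by exact_mod_cast (h.natCast_pos j).ne'), Complex.natCast_log]

/-- Domination by the summable `b` upgrades coordinatewise convergence to norm convergence, and
multipliers are continuous. -/
theorem mem_multiplierVariety_of_tendsto [Nonempty ι] (h : IsAdmissible b n) {z : EllTwo ι}
    (hz : ‖z‖ < 1) (hzb : ∀ j, ‖z j‖ ^ 2 ≤ b j) (s : ℕ → {s : ℂ // 0 ≤ s.re})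
    (hs : ∀ t, 0 < (s t : ℂ).re)
    (hlim : ∀ j, Tendsto (fun t => h.curve (s t) j) atTop (𝓝 (z j))) :
    z ∈ h.multiplierVariety := by
  have hz' : z ∈ Metric.ball (0 : EllTwo ι) 1 := mem_ball_zero_iff.2 hz
  refine ⟨hz', fun g hg hg0 => ?_⟩
  have htend : Tendsto (fun t => h.curve (s t)) atTop (𝓝 z) :=
    EllTwo.tendsto_of_dominated h.summable (fun t j => h.norm_sq_coord_le (s t).2 j) hzb hlim
  have hball : ∀ t, h.curve (s t) ∈ Metric.ball (0 : EllTwo ι) 1 := fun t =>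
    h.curve_image_subset_ball ⟨s t, hs t, rfl⟩
  have htend' : Tendsto (fun t => (⟨h.curve (s t), hball t⟩ : UnitBall ι)) atTop (𝓝 ⟨z, hz'⟩) :=
    tendsto_subtype_rng.2 htend
  have h1 := (hg.continuous.tendsto _).comp htend'
  have e : (g ∘ fun t => (⟨h.curve (s t), hball t⟩ : UnitBall ι)) = fun _ => 0 := by
    ext t
    exact hg0 _ ⟨s t, hs t, rfl⟩
  rw [e] at h1
  exact tendsto_nhds_unique h1 tendsto_const_nhds

theorem curve_mem_multiplierVariety_of_pos [Nonempty ι] (h : IsAdmissible b n)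
    {s : {s : ℂ // 0 ≤ s.re}} (hs : 0 < (s : ℂ).re) : h.curve s ∈ h.multiplierVariety :=
  ⟨h.curve_image_subset_ball ⟨s, hs, rfl⟩, fun _ _ hg0 => hg0 _ ⟨s, hs, rfl⟩⟩

theorem zero_mem_multiplierVariety [Nonempty ι] (h : IsAdmissible b n) :
    0 ∈ h.multiplierVariety := by
  refine h.mem_multiplierVariety_of_tendsto (by simp) (fun j => by simpa using (h.pos j).le)
    (fun t => ⟨((t + 1 : ℕ) : ℂ), by simp only [Complex.natCast_re]; positivity⟩)
    (fun t => by simp only [Complex.natCast_re]; positivity) fun j => ?_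
  simp only [curve_apply, Complex.cpow_neg, Complex.cpow_natCast, ← inv_pow]
  have h1 : ‖((n j : ℂ))⁻¹‖ < 1 := by
    rw [norm_inv, Complex.norm_natCast]
    exact inv_lt_one_of_one_lt₀ (by exact_mod_cast lt_of_lt_of_le one_lt_two (h.two_le j))
  have h2 := ((tendsto_pow_atTop_nhds_zero_of_norm_lt_one h1).comp
    (tendsto_add_atTop_nat 1)).const_mul
    ((√(b j) : ℝ) : ℂ)
  simpa using h2

theorem norm_curve_lt_one (h : IsAdmissible b n) (hb : ∑' j, b j < 1)
    (s : {s : ℂ // 0 ≤ s.re}) : ‖h.curve s‖ < 1 := by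
  have h1 : ‖h.curve s‖ ^ 2 < 1 := by
    rw [EllTwo.norm_sq_eq_tsum]
    have hle : ∀ j, ‖h.curve s j‖ ^ 2 ≤ b j := h.norm_sq_coord_le s.2
    exact ((EllTwo.summable_norm_sq (h.curve s)).tsum_le_tsum hle h.summable).trans_lt hb
  nlinarith [norm_nonneg (h.curve s)]

theorem curve_mem_multiplierVariety [Nonempty ι] (h : IsAdmissible b n) (hb : ∑' j, b j < 1)
    (s : {s : ℂ // 0 ≤ s.re}) : h.curve s ∈ h.multiplierVariety := by
  -- Approach `s`, possibly on the imaginary axis, from the open half-plane.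
  have hpos : ∀ t : ℕ, 0 < ((s : ℂ) + ((1 / ((t : ℝ) + 1) : ℝ) : ℂ)).re := fun t => by
    rw [Complex.add_re, Complex.ofReal_re]
    have := s.2
    positivity
  refine h.mem_multiplierVariety_of_tendsto (h.norm_curve_lt_one hb s)
    (h.norm_sq_coord_le s.2) (fun t => ⟨_, (hpos t).le⟩) hpos fun j => ?_
  simp only [curve_apply, h.natCast_cpow_eq_exp]
  have h1 : Tendsto (fun t : ℕ => (s : ℂ) + ((1 / ((t : ℝ) + 1) : ℝ) : ℂ)) atTop (𝓝 s) := by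
    have := (Complex.continuous_ofReal.tendsto 0).comp
      (tendsto_one_div_add_atTop_nhds_zero_nat (𝕜 := ℝ))
    simpa [Function.comp_def] using this.const_add (s : ℂ)
  have hc : Continuous fun u : ℂ => (√(b j) : ℂ) * Complex.exp (Real.log (n j) * -u) := by
    fun_prop
  exact (hc.tendsto _).comp h1

/-- Points of the multiplier variety satisfy the monomial relations of the curve. -/
theorem monomialValue_eq_of_mem_multiplierVariety (h : IsAdmissible b n)
    {z : EllTwo ι} (hz : z ∈ h.multiplierVariety) {p q : ι →₀ ℕ}
    (hpq : Finsupp.linearCombination ℕ (fun j => Real.log (n j)) p =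
      Finsupp.linearCombination ℕ (fun j => Real.log (n j)) q) :
    monomialValue (fun j => (√(b j) : ℂ)⁻¹ * z j) p =
      monomialValue (fun j => (√(b j) : ℂ)⁻¹ * z j) q := by
  obtain ⟨hzb, hz⟩ := hz
  have hmult : ∀ r : ι →₀ ℕ, IsMultiplier (DruryArvesonSpace ι)
      fun x : UnitBall ι => monomialValue (fun j => (√(b j) : ℂ)⁻¹ * (x : EllTwo ι) j) r :=
    fun r => IsMultiplier.finset_prod _ fun j _ => IsMultiplier.pow
      ((IsMultiplier.const _).mul (DruryArvesonSpace.isMultiplier_coord j)) _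
  refine sub_eq_zero.1 (hz _ ((hmult p).sub (hmult q)) ?_)
  rintro ⟨_, _⟩ ⟨s, _, rfl⟩
  have e : (fun j => (√(b j) : ℂ)⁻¹ * h.curve s j) =
      fun j => Complex.exp (Real.log (n j) * -(s : ℂ)) := by
    ext j
    have : (√(b j) : ℂ) ≠ 0 := by exact_mod_cast (Real.sqrt_pos.2 (h.pos j)).ne'
    rw [curve_apply, inv_mul_cancel_left₀ this, h.natCast_cpow_eq_exp]
  simp only [e, monomialValue_exp, hpq, sub_self]

/-- The multiplier variety lies in the analytic continuation of the curve, with `0` added. -/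
theorem eq_zero_or_exists_of_mem_multiplierVariety (h : IsAdmissible b n) (i₀ : ι)
    (hdep : ∀ j, ∃ c : ℚ, Real.log (n j) = c * Real.log (n i₀)) {z : EllTwo ι}
    (hz : z ∈ h.multiplierVariety) :
    z = 0 ∨ ∃ s : ℂ, ∀ j, z j = √(b j) * (n j : ℂ) ^ (-s) := by
  obtain ⟨g, hg, hgL, hL⟩ := exists_closure_log_eq_zmultiples n h.two_le i₀ hdep
  have hb : ∀ j, (√(b j) : ℂ) ≠ 0 := fun j => by
    exact_mod_cast (Real.sqrt_pos.2 (h.pos j)).ne'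
  rcases eq_zero_or_exists_eq_exp hg hgL hL
    (fun p q hpq => h.monomialValue_eq_of_mem_multiplierVariety hz hpq) with h0 | ⟨s, hs⟩
  · left
    ext j
    simpa [hb j] using h0 j
  · refine Or.inr ⟨s, fun j => ?_⟩
    rw [h.natCast_cpow_eq_exp, ← hs j, mul_inv_cancel_left₀ (hb j)]

theorem summable_and_tsum_lt_one (h : IsAdmissible b n) {z : EllTwo ι} (hz : ‖z‖ < 1) {s : ℂ}
    (hs : ∀ j, z j = √(b j) * (n j : ℂ) ^ (-s)) :
    Summable (fun j => b j * (n j : ℝ) ^ (-(2 * s.re))) ∧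
      ∑' j, b j * (n j : ℝ) ^ (-(2 * s.re)) < 1 := by
  have e : (fun j => b j * (n j : ℝ) ^ (-(2 * s.re))) = fun j => ‖z j‖ ^ 2 := by
    ext j
    rw [hs, h.norm_sq_coord]
  rw [e, ← EllTwo.norm_sq_eq_tsum]
  exact ⟨EllTwo.summable_norm_sq z, pow_lt_one₀ (norm_nonneg _) hz two_ne_zero⟩

/-- For `Re s ≤ 0` each term is at least `b_j`, so the sum would be at least `1`. -/
theorem re_pos_of_tsum_eq_one (h : IsAdmissible b n) (hb : ∑' j, b j = 1) {s : ℂ}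
    (hs : Summable fun j => b j * (n j : ℝ) ^ (-(2 * s.re)))
    (hlt : ∑' j, b j * (n j : ℝ) ^ (-(2 * s.re)) < 1) : 0 < s.re := by
  by_contra! h0
  refine absurd hlt (not_lt.2 ?_)
  rw [← hb]
  refine h.summable.tsum_le_tsum (fun j => ?_) hs
  refine le_mul_of_one_le_right (h.pos j).le (Real.one_le_rpow ?_ (by linarith))
  exact_mod_cast le_trans one_le_two (h.two_le j)

theorem abscissa_le_of_summable (h : IsAdmissible b n) {x : ℝ}
    (hs : Summable fun j => b j * (n j : ℝ) ^ (-x)) : abscissa b n ≤ x := by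
  have h1 : LSeriesSummable (Function.extend n (fun j => (b j : ℂ)) 0) (x : ℂ) := by
    unfold LSeriesSummable
    -- The coefficients vanish off the range of `n`, so the series over all integers reduces to one
    -- over the index set.
    rw [← h.injective.summable_iff]
    · have e : (LSeries.term (Function.extend n (fun j => (b j : ℂ)) 0) (x : ℂ) ∘ n) =
          fun j => ((b j * (n j : ℝ) ^ (-x) : ℝ) : ℂ) := by
        ext j
        rw [Function.comp_apply, LSeries.term_of_ne_zero (h.natCast_pos j).ne',
          h.injective.extend_apply, Real.rpow_neg (Nat.cast_nonneg _)]
        push_cast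
        rw [Complex.ofReal_cpow (Nat.cast_nonneg _), Complex.ofReal_natCast, div_eq_mul_inv]
      rw [e]
      exact Complex.summable_ofReal.2 hs
    · intro N hN
      rw [LSeries.term_def, Function.extend_apply' _ _ _ (by simpa using hN)]
      simp
  simpa [abscissa] using h1.abscissaOfAbsConv_le

end IsAdmissible

theorem corollary4p9 (d : ℕ∞) (hd : 2 ≤ d) (b : TupleIndex d → ℝ) (n : TupleIndex d → ℕ)
    (h : IsAdmissible b n)
    (hdep : ∀ i : TupleIndex d, i ≠ TupleIndex.first hd →
      ¬ LinearIndependent ℚ ![Real.log (n (TupleIndex.first hd)), Real.log (n i)]) :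
    (∑' j, b j = 1 →
      h.multiplierVariety = h.curve '' {s | 0 < (s : ℂ).re} ∪ {0}) ∧
    (∑' j, b j < 1 → abscissa b n = 0 →
      h.multiplierVariety = h.curve '' {s | 0 ≤ (s : ℂ).re} ∪ {0}) := by
  have : Nonempty (TupleIndex d) := ⟨TupleIndex.first hd⟩
  have hne : Real.log (n (TupleIndex.first hd)) ≠ 0 :=
    (Real.log_pos (by exact_mod_cast lt_of_lt_of_le one_lt_two (h.two_le _))).ne'
  have hdep' : ∀ j, ∃ c : ℚ, Real.log (n j) = c * Real.log (n (TupleIndex.first hd)) := by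
    intro j
    by_cases hj : j = TupleIndex.first hd
    · exact ⟨1, by simp [hj]⟩
    · have h1 := hdep j hj
      rw [LinearIndependent.pair_iff' hne] at h1
      push Not at h1
      obtain ⟨c, hc⟩ := h1
      exact ⟨c, by rw [← hc, Rat.smul_def]⟩
  constructor
  · intro hb
    refine Set.Subset.antisymm (fun z hz => ?_) ?_
    · rcases h.eq_zero_or_exists_of_mem_multiplierVariety _ hdep' hz with rfl | ⟨s, hs⟩
      · exact Or.inr rfl
      · obtain ⟨h1, h2⟩ := h.summable_and_tsum_lt_one (mem_ball_zero_iff.1 hz.1) hs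
        have h3 := h.re_pos_of_tsum_eq_one hb h1 h2
        exact Or.inl ⟨⟨s, h3.le⟩, h3, by ext j; rw [h.curve_apply, hs]⟩
    · rintro _ (⟨s, hs, rfl⟩ | rfl)
      · exact h.curve_mem_multiplierVariety_of_pos hs
      · exact h.zero_mem_multiplierVariety
  · intro hb ha
    refine Set.Subset.antisymm (fun z hz => ?_) ?_
    · rcases h.eq_zero_or_exists_of_mem_multiplierVariety _ hdep' hz with rfl | ⟨s, hs⟩
      · exact Or.inr rfl
      · obtain ⟨h1, _⟩ := h.summable_and_tsum_lt_one (mem_ball_zero_iff.1 hz.1) hs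
        have h2 := h.abscissa_le_of_summable h1
        rw [ha] at h2
        have h3 : (0 : ℝ) ≤ 2 * s.re := by exact_mod_cast h2
        have h4 : 0 ≤ s.re := by linarith
        exact Or.inl ⟨⟨s, h4⟩, h4, by ext j; rw [h.curve_apply, hs]⟩
    · rintro _ (⟨s, _, rfl⟩ | rfl)
      · exact h.curve_mem_multiplierVariety hb s
      · exact h.zero_mem_multiplierVariety
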